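/- Let $V$ be a finite set and let $\mathbf{X}=(X_v)_{v\in V}$ be a Gaussian random vector with values in $\mathbb{R}^V$ (with arbitrary mean and arbitrary, possibly singular, covariance matrix). For $A\subseteq V$ write $\mathbf{X}_A=(X_v)_{v\in A}$, and let the conditional independence structure $[\mathbf{X}]$ be the set of all triples $(A,B|C)$ of pairwise disjoint subsets of $V$, with $A$ and $B$ nonempty, such that $\mathbf{X}_A$ and $\mathbf{X}_B$ are conditionally independent given $\mathbf{X}_C$. Then $[\mathbf{X}]$ is closed under dual decomposable transitivity: for all distinct $a,c,e\in V$ and all disjoint (possibly empty) sets $B,D\subseteq V\setminus\{a,c,e\}$, if $$(\{a\}\cup B,\ D\cup\{e\}\ |\ V\setminus(\{a,c,e\}\cup B\cup D))\in[\mathbf{X}]\quad\text{and}\quad (\{a\},\{e\}\ |\ V\setminus(\{a,e\}\cup B\cup D))\in[\mathbf{X}],$$ then $$(\{a\},\{c\}\ |\ V\setminus(\{a,c\}\cup B))\in[\mathbf{X}]\quad\text{or}\quad(\{c\},\{e\}\ |\ V\setminus(\{c,e\}\cup D))\in[\mathbf{X}].$$ -/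

import Mathlib

open MeasureTheory ProbabilityTheory

namespace CIStructure

/-- The set `𝒯(V)` of all triples `(A, B | C)` of pairwise disjoint subsets of `V` with
`A` and `B` nonempty. The triple `(A, B | C)` is encoded as `(A, B, C)`. -/
def triples (V : Type*) : Set (Finset V × Finset V × Finset V) :=
  {t | t.1.Nonempty ∧ t.2.1.Nonempty ∧
    Disjoint t.1 t.2.1 ∧ Disjoint t.1 t.2.2 ∧ Disjoint t.2.1 t.2.2}

/-- For a probability measure `μ` on `ℝ^V` (the law of a random vector), the subvectors of
coordinates in `A` and in `B` are conditionally independent given the (σ-algebra generated by the)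
subvector of coordinates in `C`. -/
def CondIndepCoords {V : Type*} [Fintype V] (μ : Measure (V → ℝ)) [IsFiniteMeasure μ]
    (A B C : Finset V) : Prop :=
  CondIndepFun
    (MeasurableSpace.comap (C.restrict : (V → ℝ) → (C → ℝ)) inferInstance)
    (Finset.measurable_restrict C).comap_le
    (A.restrict : (V → ℝ) → (A → ℝ)) (B.restrict : (V → ℝ) → (B → ℝ)) μ

/-- The conditional independence structure `[X]` of a random vector `X = (X_v)_{v ∈ V}`:
the relation of all triples `(A, B | C)` such that `X_A` and `X_B` are conditionally independent
given `X_C` under the law of `X`. -/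
def ciStructure {Ω V : Type*} [MeasurableSpace Ω] [Fintype V]
    (X : Ω → V → ℝ) (P : Measure Ω) [IsFiniteMeasure P] :
    Set (Finset V × Finset V × Finset V) :=
  {t | t ∈ triples V ∧ CondIndepCoords (P.map X) t.1 t.2.1 t.2.2}

/-- A relation `L` is closed under dual decomposable transitivity if, for all pairwise disjoint
`{a}, B, {c}, D, {e} ⊆ V` (where `B` and `D` may be empty),
`(aB, De | V \ aBcDe), (a, e | V \ aBDe) ∈ L` implies
`(a, c | V \ aBc) ∈ L` or `(c, e | V \ cDe) ∈ L`. -/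
def ClosedUnderDualDecomposableTransitivity {V : Type*} [Fintype V] [DecidableEq V]
    (L : Set (Finset V × Finset V × Finset V)) : Prop :=
  ∀ (a c e : V) (B D : Finset V),
    a ≠ c → a ≠ e → c ≠ e →
    a ∉ B → c ∉ B → e ∉ B → a ∉ D → c ∉ D → e ∉ D → Disjoint B D →
    ({a} ∪ B, D ∪ {e}, Finset.univ \ ({a} ∪ B ∪ {c} ∪ D ∪ {e})) ∈ L →
    ({a}, {e}, Finset.univ \ ({a} ∪ B ∪ D ∪ {e})) ∈ L →
      ({a}, {c}, Finset.univ \ ({a} ∪ B ∪ {c})) ∈ L ∨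
      ({c}, {e}, Finset.univ \ ({c} ∪ D ∪ {e})) ∈ L

end CIStructure

/-!
The conditional independence of two single coordinates of a Gaussian vector is a statement about
covariances of residuals. Regress `X_a` on `X_C` to obtain a residual `r`, a linear functional that
differs from `X_a` by a combination of the `X_c`, `c ∈ C`, and is uncorrelated with them. Such
residuals exist for singular covariances too, by Gram–Schmidt (`exists_isResidual`). Since the
residuals of `X_a` and `X_b` are jointly Gaussian and uncorrelated with `X_C`, their pair is
independent of `X_C`, and `X_a`, `X_b` are conditionally independent given `X_C` if and only if
`Cov(r, X_b) = 0` (`condIndepCoords_singleton_iff`).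

Let `C` be the complement of `{a} ∪ B ∪ {c} ∪ D ∪ {e}`, and let `r`, `s`, `q` be the residuals of
`X_a`, `X_e`, `X_c` on `X_C`. The first hypothesis says that `r` is uncorrelated with `X_D` and
`X_e`, hence is still the residual of `X_a` on `C ∪ D ∪ {e}` (`IsResidual.mono`); symmetrically for
`s` and `C ∪ {a} ∪ B`. So the two alternatives of the conclusion are `Cov(r, X_c) = 0` and
`Cov(s, X_c) = 0`. The second hypothesis conditions on `C ∪ {c}` and reads
`Cov(r, s) = Cov(r, q) Cov(q, s) / Var(q)`. As `Cov(r, s) = 0`, one of the factors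
`Cov(r, q) = Cov(r, X_c)` and `Cov(q, s) = Cov(s, X_c)` vanishes; if `Var(q) = 0`, both do
(`cov_coord_eq_zero_or`).
-/

namespace CIStructure

/-! ### Conditional independence given an adjoined or independent variable -/

section CondIndep

variable {Ω β β' γ : Type*} {mΩ : MeasurableSpace Ω} [StandardBorelSpace Ω]
  {mβ : MeasurableSpace β} {mβ' : MeasurableSpace β'} {mγ : MeasurableSpace γ}
  {μ : Measure Ω} {f : Ω → β} {g : Ω → β'} {k : Ω → γ}

/-- The σ-algebra of `(f, k)` is generated by the rectangle events `f ∈ s, k ∈ t`, for which the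
claim reduces to the hypothesis on `f ∈ s`. -/
theorem condIndepFun_prodMk_left [IsFiniteMeasure μ] (hf : Measurable f) (hg : Measurable g)
    (hk : Measurable k) (h : f ⟂ᵢ[k, hk; μ] g) :
    (fun ω ↦ (f ω, k ω)) ⟂ᵢ[k, hk; μ] g := by
  rw [condIndepFun_iff_condIndep]
  refine CondIndepSets.condIndep
    (p1 := Set.preimage (fun ω ↦ (f ω, k ω)) ''
      Set.image2 (· ×ˢ ·) {s | MeasurableSet s} {t | MeasurableSet t})
    (p2 := {s | MeasurableSet[mβ'.comap g] s})
    (hf.prodMk hk).comap_le hg.comap_le ?_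
    (@MeasurableSpace.isPiSystem_measurableSet _ (mβ'.comap g)) ?_
    (@MeasurableSpace.generateFrom_measurableSet _ (mβ'.comap g)).symm ?_
  · exact isPiSystem_prod.comap _
  · rw [← MeasurableSpace.comap_generateFrom, generateFrom_prod]
  rw [condIndepSets_iff]
  rotate_left
  · rintro _ ⟨_, ⟨s, hs, t, ht, rfl⟩, rfl⟩
    exact (hf.prodMk hk) (hs.prod ht)
  · exact fun s hs ↦ hg.comap_le s hs
  rintro _ _ ⟨_, ⟨s, hs, t, ht, rfl⟩, rfl⟩ ⟨u, hu, rfl⟩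
  rw [condIndepFun_iff_condExp_inter_preimage_eq_mul hf hg] at h
  have ht' : MeasurableSet[mγ.comap k] (k ⁻¹' t) := ⟨t, ht, rfl⟩
  -- A `k`-measurable event factors out of every conditional probability given `k`.
  have pull (A : Set Ω) (hA : MeasurableSet A) :
      μ⟦k ⁻¹' t ∩ A | mγ.comap k⟧ =ᵐ[μ] (k ⁻¹' t).indicator (μ⟦A | mγ.comap k⟧) := by
    rw [← Set.indicator_indicator]
    exact condExp_indicator ((integrable_const 1).indicator hA) ht'
  have e1 : (fun ω ↦ (f ω, k ω)) ⁻¹' (s ×ˢ t) = k ⁻¹' t ∩ f ⁻¹' s := by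
    ext ω; simp [and_comm]
  have h1 := pull _ ((hf hs).inter (hg hu))
  have h2 := pull _ (hf hs)
  rw [e1, Set.inter_assoc]
  filter_upwards [h1, h2, h s u hs hu] with ω a1 a2 a3
  rw [a1, Pi.mul_apply, a2]
  by_cases hω : ω ∈ k ⁻¹' t <;> simp [hω, a3]

/-- The conditioning variable may be adjoined to both conditionally independent variables. -/
theorem condIndepFun_prodMk_prodMk [IsFiniteMeasure μ] (hf : Measurable f) (hg : Measurable g)
    (hk : Measurable k) (h : f ⟂ᵢ[k, hk; μ] g) :
    (fun ω ↦ (f ω, k ω)) ⟂ᵢ[k, hk; μ] (fun ω ↦ (g ω, k ω)) :=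
  (condIndepFun_prodMk_left hg (hf.prodMk hk) hk
    (condIndepFun_prodMk_left hf hg hk h).symm).symm

/-- If the pair `(f, g)` is independent of `k`, conditioning on `k` changes no probability of an
event determined by `(f, g)`, so conditional independence given `k` is plain independence. -/
theorem condIndepFun_iff_indepFun_of_indepFun_prodMk [IsProbabilityMeasure μ]
    (hf : Measurable f) (hg : Measurable g) (hk : Measurable k)
    (h : IndepFun (fun ω ↦ (f ω, g ω)) k μ) :
    f ⟂ᵢ[k, hk; μ] g ↔ IndepFun f g μ := by
  have key (S : Set (β × β')) (hS : MeasurableSet S) :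
      μ⟦(fun ω ↦ (f ω, g ω)) ⁻¹' S | mγ.comap k⟧ =ᵐ[μ]
        fun _ ↦ μ.real ((fun ω ↦ (f ω, g ω)) ⁻¹' S) := by
    have := condExp_indep_eq (f := ((fun ω ↦ (f ω, g ω)) ⁻¹' S).indicator fun _ ↦ (1 : ℝ))
      (hf.prodMk hg).comap_le hk.comap_le
      (stronglyMeasurable_const.indicator ⟨S, hS, rfl⟩) h
    filter_upwards [this] with ω hω
    rw [hω, integral_indicator_const _ ((hf.prodMk hg) hS)]
    simp
  rw [condIndepFun_iff_condExp_inter_preimage_eq_mul hf hg,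
    indepFun_iff_measure_inter_preimage_eq_mul]
  refine forall₂_congr fun s t ↦ forall₂_congr fun hs ht ↦ ?_
  have a1 := key (s ×ˢ t) (hs.prod ht)
  have a2 := key (s ×ˢ Set.univ) (hs.prod .univ)
  have a3 := key (Set.univ ×ˢ t) (MeasurableSet.univ.prod ht)
  have e1 : (fun ω ↦ (f ω, g ω)) ⁻¹' (s ×ˢ t) = f ⁻¹' s ∩ g ⁻¹' t := rfl
  have e2 : (fun ω ↦ (f ω, g ω)) ⁻¹' (s ×ˢ Set.univ) = f ⁻¹' s := by ext; simp
  have e3 : (fun ω ↦ (f ω, g ω)) ⁻¹' (Set.univ ×ˢ t) = g ⁻¹' t := by ext; simp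
  rw [e1] at a1
  rw [e2] at a2
  rw [e3] at a3
  have real_iff : μ (f ⁻¹' s ∩ g ⁻¹' t) = μ (f ⁻¹' s) * μ (g ⁻¹' t) ↔
      μ.real (f ⁻¹' s ∩ g ⁻¹' t) = μ.real (f ⁻¹' s) * μ.real (g ⁻¹' t) := by
    simp only [measureReal_def, ← ENNReal.toReal_mul]
    rw [ENNReal.toReal_eq_toReal_iff' (by finiteness) (by finiteness)]
  rw [real_iff]
  constructor
  · intro hst
    obtain ⟨ω, b1, b2, b3, b⟩ := (a1.and (a2.and (a3.and hst))).exists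
    exact b1.symm.trans (b.trans (congrArg₂ (· * ·) b2 b3))
  · intro hst
    filter_upwards [a1, a2, a3] with ω b1 b2 b3
    exact b1.trans (hst.trans (congrArg₂ (· * ·) b2 b3).symm)

end CondIndep

/-! ### Residuals of linear regression under a possibly singular covariance -/

section Residual

/-- The coordinate `X_v` as a continuous linear functional on `ℝ^V`. -/
abbrev coord {V : Type*} (v : V) : StrongDual ℝ (V → ℝ) := ContinuousLinearMap.proj v

/-- A linear combination of the coordinates in `C` is a function of `X_C`. -/
theorem exists_measurable_comp_restrict {V : Type*} {C : Finset V} {L : StrongDual ℝ (V → ℝ)}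
    (hL : L ∈ Submodule.span ℝ (coord '' (C : Set V))) :
    ∃ φ : (C → ℝ) → ℝ, Measurable φ ∧ ∀ x, L x = φ (C.restrict x) := by
  induction hL using Submodule.span_induction with
  | mem x hx =>
    obtain ⟨c, hc, rfl⟩ := hx
    exact ⟨fun y ↦ y ⟨c, hc⟩, measurable_pi_apply _, fun _ ↦ rfl⟩
  | zero => exact ⟨0, measurable_zero, fun _ ↦ rfl⟩
  | add x y _ _ hx hy =>
    obtain ⟨φ, hφ, h⟩ := hx
    obtain ⟨ψ, hψ, h'⟩ := hy
    exact ⟨φ + ψ, hφ.add hψ, fun z ↦ by simp [h, h']⟩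
  | smul t x _ hx =>
    obtain ⟨φ, hφ, h⟩ := hx
    exact ⟨t • φ, hφ.const_smul t, fun z ↦ by simp [h]⟩

variable {V : Type*} [Fintype V] {μ : Measure (V → ℝ)}

/-- The functional `r` is a residual of the regression of the coordinate `X_a` on the coordinates
`X_c`, `c ∈ C`: it differs from `X_a` by a linear combination of these coordinates, and is
uncorrelated with each of them. Residuals need not be unique as functionals when the covariance
is singular. -/
structure IsResidual (μ : Measure (V → ℝ)) (C : Finset V) (a : V)
    (r : StrongDual ℝ (V → ℝ)) : Prop where
  sub_mem : r - coord a ∈ Submodule.span ℝ (coord '' (C : Set V))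
  cov_eq_zero : ∀ c ∈ C, covarianceBilinDual μ r (coord c) = 0

theorem cov_eq_zero_of_mem_span {C : Finset V} {r L : StrongDual ℝ (V → ℝ)}
    (hr : ∀ c ∈ C, covarianceBilinDual μ r (coord c) = 0)
    (hL : L ∈ Submodule.span ℝ (coord '' (C : Set V))) :
    covarianceBilinDual μ r L = 0 := by
  induction hL using Submodule.span_induction with
  | mem x hx =>
    obtain ⟨c, hc, rfl⟩ := hx
    exact hr c hc
  | zero => simp
  | add x y _ _ hx hy => simp [hx, hy]
  | smul t x _ hx => simp [hx]

/-- A functional uncorrelated with `X_C` has the same covariance with `X_b` and with any residual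
of `X_b` on `X_C`. -/
theorem IsResidual.cov_coord_eq {C : Finset V} {b : V} {r s : StrongDual ℝ (V → ℝ)}
    (hr : ∀ c ∈ C, covarianceBilinDual μ r (coord c) = 0) (hs : IsResidual μ C b s) :
    covarianceBilinDual μ r (coord b) = covarianceBilinDual μ r s := by
  have := cov_eq_zero_of_mem_span hr hs.sub_mem
  rw [map_sub, sub_eq_zero] at this
  exact this.symm

/-- A residual on `X_C` that is also uncorrelated with further coordinates is a residual on the
larger set: this is why adding the far side of a conditional independence to the conditioning set
needs no new regression. -/
theorem IsResidual.mono {C C' : Finset V} {a : V} {r : StrongDual ℝ (V → ℝ)}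
    (hr : IsResidual μ C a r) (hC : C ⊆ C')
    (h : ∀ c ∈ C', c ∉ C → covarianceBilinDual μ r (coord c) = 0) : IsResidual μ C' a r where
  sub_mem := Submodule.span_mono (Set.image_mono (by exact_mod_cast hC)) hr.sub_mem
  cov_eq_zero c hc := by
    by_cases hcC : c ∈ C
    · exact hr.cov_eq_zero c hcC
    · exact h c hc hcC

/-- By the Cauchy–Schwarz inequality, a functional of variance zero is uncorrelated with all
others. -/
theorem cov_eq_zero_of_self_eq_zero {r s : StrongDual ℝ (V → ℝ)}
    (hs : covarianceBilinDual μ s s = 0) : covarianceBilinDual μ r s = 0 := by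
  have h := LinearMap.BilinForm.apply_sq_le_of_symm (covarianceBilinDual μ).toBilinForm
    (fun x ↦ covarianceBilinDual_self_nonneg x) ⟨fun x y ↦ covarianceBilinDual_comm x y⟩ r s
  have h' : (covarianceBilinDual μ r s) ^ 2 ≤
    covarianceBilinDual μ r r * covarianceBilinDual μ s s := h
  rw [hs, mul_zero] at h'
  exact pow_eq_zero_iff two_ne_zero |>.1 (le_antisymm h' (sq_nonneg _))

/-- One Gram–Schmidt step. If `s` has variance zero the quotient is `x / 0 = 0`, which is the
right coefficient since `s` is then uncorrelated with `r`. -/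
theorem IsResidual.sub_smul [DecidableEq V] {C : Finset V} {a c : V} {r s : StrongDual ℝ (V → ℝ)}
    (hr : IsResidual μ C a r) (hs : IsResidual μ C c s) :
    IsResidual μ (insert c C) a
      (r - (covarianceBilinDual μ r s / covarianceBilinDual μ s s) • s) := by
  set t := covarianceBilinDual μ r s / covarianceBilinDual μ s s with ht
  have hle : Submodule.span ℝ (coord '' (C : Set V)) ≤
      Submodule.span ℝ (coord '' ((insert c C : Finset V) : Set V)) :=
    Submodule.span_mono (Set.image_mono (by simp))
  have hC : ∀ d ∈ C, covarianceBilinDual μ (r - t • s) (coord d) = 0 := fun d hd ↦ by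
    simp [hr.cov_eq_zero d hd, hs.cov_eq_zero d hd]
  constructor
  · have e : r - t • s - coord a = (r - coord a) - t • (s - coord c) - t • coord c := by
      rw [smul_sub]; abel
    rw [e]
    refine Submodule.sub_mem _ (Submodule.sub_mem _ (hle hr.sub_mem)
      (Submodule.smul_mem _ _ (hle hs.sub_mem))) (Submodule.smul_mem _ _ ?_)
    exact Submodule.subset_span ⟨c, by simp, rfl⟩
  · intro d hd
    rcases Finset.mem_insert.1 hd with rfl | hd
    · rw [hs.cov_coord_eq hC]
      by_cases h0 : covarianceBilinDual μ s s = 0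
      · exact cov_eq_zero_of_self_eq_zero h0
      · simp [ht, h0]
    · exact hC d hd

theorem exists_isResidual (μ : Measure (V → ℝ)) (C : Finset V) (a : V) :
    ∃ r, IsResidual μ C a r := by
  classical
  induction C using Finset.induction generalizing a with
  | empty => exact ⟨coord a, by simp, by simp⟩
  | insert c C _ ih =>
    obtain ⟨r, hr⟩ := ih a
    obtain ⟨s, hs⟩ := ih c
    exact ⟨_, hr.sub_smul hs⟩

end Residual

/-! ### Partial covariance and Gaussian conditional independence -/

section Gaussian

variable {V : Type*} [Fintype V] {μ : Measure (V → ℝ)}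

theorem CondIndepCoords.mono [IsFiniteMeasure μ] {A A' B B' C : Finset V}
    (h : CondIndepCoords μ A B C) (hA : A' ⊆ A) (hB : B' ⊆ B) : CondIndepCoords μ A' B' C :=
  CondIndepFun.comp (φ := Finset.restrict₂ (π := fun _ ↦ ℝ) hA)
    (ψ := Finset.restrict₂ (π := fun _ ↦ ℝ) hB) h
    (Finset.measurable_restrict₂ hA) (Finset.measurable_restrict₂ hB)

/-- Given `X_C`, a coordinate and its residual are measurable functions of each other. -/
theorem condIndepCoords_singleton_iff_residual [IsFiniteMeasure μ] {C : Finset V} {a b : V}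
    {r s : StrongDual ℝ (V → ℝ)} (hr : IsResidual μ C a r) (hs : IsResidual μ C b s) :
    CondIndepCoords μ {a} {b} C ↔ r ⟂ᵢ[C.restrict, Finset.measurable_restrict C; μ] s := by
  obtain ⟨φ, hφ, hφr⟩ := exists_measurable_comp_restrict hr.sub_mem
  obtain ⟨ψ, hψ, hψs⟩ := exists_measurable_comp_restrict hs.sub_mem
  have hφr' (x : V → ℝ) : r x = x a + φ (C.restrict x) := by simp [← hφr]
  have hψs' (x : V → ℝ) : s x = x b + ψ (C.restrict x) := by simp [← hψs]
  constructor
  · intro h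
    have := condIndepFun_prodMk_prodMk (Finset.measurable_restrict _) (Finset.measurable_restrict _)
      (Finset.measurable_restrict C) h
    convert! this.comp (φ := fun p ↦ p.1 ⟨a, Finset.mem_singleton_self a⟩ + φ p.2)
      (ψ := fun p ↦ p.1 ⟨b, Finset.mem_singleton_self b⟩ + ψ p.2) (by fun_prop) (by fun_prop)
      using 1
    · ext x; simp [hφr']
    · ext x; simp [hψs']
  · intro h
    have := condIndepFun_prodMk_prodMk r.continuous.measurable s.continuous.measurable
      (Finset.measurable_restrict C) h
    unfold CondIndepCoords
    convert! this.comp (φ := fun p ↦ fun _ : ({a} : Finset V) ↦ p.1 - φ p.2)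
      (ψ := fun p ↦ fun _ : ({b} : Finset V) ↦ p.1 - ψ p.2) (by fun_prop) (by fun_prop)
      using 1
    · ext x ⟨i, hi⟩
      obtain rfl := Finset.mem_singleton.1 hi
      simp [hφr']
    · ext x ⟨i, hi⟩
      obtain rfl := Finset.mem_singleton.1 hi
      simp [hψs']

variable [IsGaussian μ]

theorem covarianceBilinDual_eq_cov (L M : StrongDual ℝ (V → ℝ)) :
    covarianceBilinDual μ L M = cov[L, M; μ] :=
  covarianceBilinDual_eq_covariance (IsGaussian.memLp_two_id) L M

theorem indepFun_iff_cov_eq_zero (L M : StrongDual ℝ (V → ℝ)) :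
    IndepFun L M μ ↔ covarianceBilinDual μ L M = 0 := by
  have hid : HasGaussianLaw id μ := IsGaussian.hasGaussianLaw_id
  rw [covarianceBilinDual_eq_cov]
  exact ⟨fun h ↦ h.covariance_eq_zero (hid.map L).memLp_two (hid.map M).memLp_two,
    fun h ↦ HasGaussianLaw.indepFun_of_covariance_eq_zero (hid.map (L.prod M)) h⟩

theorem indepFun_prodMk_restrict {C : Finset V} {r s : StrongDual ℝ (V → ℝ)}
    (hr : ∀ c ∈ C, covarianceBilinDual μ r (coord c) = 0)
    (hs : ∀ c ∈ C, covarianceBilinDual μ s (coord c) = 0) :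
    IndepFun (fun x ↦ (r x, s x)) (C.restrict : (V → ℝ) → (C → ℝ)) μ := by
  have hid : HasGaussianLaw id μ := IsGaussian.hasGaussianLaw_id
  have h : IndepFun (fun x i ↦ (![r, s] i) x) (fun x (c : C) ↦ coord c.1 x) μ := by
    refine HasGaussianLaw.indepFun_of_covariance_eval (X := fun i x ↦ (![r, s] i) x)
      (Y := fun (c : C) x ↦ coord c.1 x) (hid.map ((ContinuousLinearMap.pi ![r, s]).prod
      (ContinuousLinearMap.pi fun c : C ↦ coord c.1))) fun i c ↦ ?_
    have : covarianceBilinDual μ (![r, s] i) (coord c.1) = 0 := by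
      fin_cases i
      · exact hr c.1 c.2
      · exact hs c.1 c.2
    rwa [covarianceBilinDual_eq_cov] at this
  exact h.comp (φ := fun y ↦ (y 0, y 1)) (by fun_prop) measurable_id

/-- For a Gaussian measure, `X_a` and `X_b` are conditionally independent given `X_C` exactly when
the partial covariance vanishes; it suffices to pass to the residual in one of the two arguments. -/
theorem condIndepCoords_singleton_iff {C : Finset V} {a b : V} {r : StrongDual ℝ (V → ℝ)}
    (hr : IsResidual μ C a r) :
    CondIndepCoords μ {a} {b} C ↔ covarianceBilinDual μ r (coord b) = 0 := by
  obtain ⟨s, hs⟩ := exists_isResidual μ C b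
  rw [condIndepCoords_singleton_iff_residual hr hs, hs.cov_coord_eq hr.cov_eq_zero,
    ← indepFun_iff_cov_eq_zero]
  exact condIndepFun_iff_indepFun_of_indepFun_prodMk r.continuous.measurable
    s.continuous.measurable (Finset.measurable_restrict C)
    (indepFun_prodMk_restrict hr.cov_eq_zero hs.cov_eq_zero)

theorem CondIndepCoords.symm {A B C : Finset V} (h : CondIndepCoords μ A B C) :
    CondIndepCoords μ B A C :=
  CondIndepFun.symm h

/-- Weak transitivity for a single extra conditioning coordinate: the partial covariance of `X_a`
and `X_e` given `X_C, X_c` is `Cov(r, s) - Cov(r, q) Cov(q, s) / Var(q)`, where `r`, `s`, `q` are the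
residuals of `X_a`, `X_e`, `X_c` on `X_C` and the last term is `0` if `Var(q) = 0`. -/
theorem cov_coord_eq_zero_or [DecidableEq V] {C : Finset V} {a c e : V}
    {r s : StrongDual ℝ (V → ℝ)} (hr : IsResidual μ C a r) (hs : IsResidual μ C e s)
    (h : covarianceBilinDual μ r (coord e) = 0) (h' : CondIndepCoords μ {a} {e} (insert c C)) :
    covarianceBilinDual μ r (coord c) = 0 ∨ covarianceBilinDual μ s (coord c) = 0 := by
  obtain ⟨q, hq⟩ := exists_isResidual μ C c
  rw [condIndepCoords_singleton_iff (hr.sub_smul hq)] at h'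
  rw [hq.cov_coord_eq hr.cov_eq_zero, hq.cov_coord_eq hs.cov_eq_zero, covarianceBilinDual_comm s q]
  simp only [map_sub, map_smul, sub_apply, smul_apply, h,
    zero_sub, neg_eq_zero, smul_eq_mul, mul_eq_zero, div_eq_zero_iff,
    hs.cov_coord_eq hq.cov_eq_zero] at h'
  rcases h' with (h' | h') | h'
  · exact .inl h'
  · exact .inl (cov_eq_zero_of_self_eq_zero h')
  · exact .inr h'

end Gaussian

end CIStructure

/-! ### Dual decomposable transitivity -/

theorem mainTheorem6 {Ω V : Type*} [MeasurableSpace Ω] [Fintype V] [DecidableEq V]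
    (P : Measure Ω) [IsProbabilityMeasure P] (X : Ω → V → ℝ) (hX : HasGaussianLaw X P) :
    CIStructure.ClosedUnderDualDecomposableTransitivity (CIStructure.ciStructure X P) := by
  intro a c e B D hac hae hce haB hcB heB haD hcD heD hBD h₁ h₂
  have := hX.isGaussian_map
  replace h₁ := h₁.2
  replace h₂ := h₂.2
  simp only at h₁ h₂
  -- The conditioning set of the first hypothesis, contained in all the others.
  set C := Finset.univ \ ({a} ∪ B ∪ {c} ∪ D ∪ {e}) with hC
  obtain ⟨r, hr⟩ := CIStructure.exists_isResidual (P.map X) C a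
  obtain ⟨s, hs⟩ := CIStructure.exists_isResidual (P.map X) C e
  have hr' : ∀ d ∈ D ∪ {e}, covarianceBilinDual (P.map X) r (CIStructure.coord d) = 0 :=
    fun d hd ↦ (CIStructure.condIndepCoords_singleton_iff hr).1
      (h₁.mono (by simp) (by simpa using hd))
  have hs' : ∀ b ∈ {a} ∪ B, covarianceBilinDual (P.map X) s (CIStructure.coord b) = 0 :=
    fun b hb ↦ (CIStructure.condIndepCoords_singleton_iff hs).1
      (h₁.mono (by simpa using hb) (by simp)).symm
  have hCc : Finset.univ \ ({a} ∪ B ∪ D ∪ {e}) = insert c C := by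
    ext v
    by_cases hv : v = c
    · subst hv; simp [*, Ne.symm]
    · simp [hC, hv]
  rw [hCc] at h₂
  -- The two conclusions say that `r`, respectively `s`, is uncorrelated with `X_c`, because they
  -- remain residuals after enlarging `C` to `C ∪ D ∪ {e}`, respectively `C ∪ {a} ∪ B`.
  refine (CIStructure.cov_coord_eq_zero_or hr hs (hr' e (by simp)) h₂).imp (fun h ↦ ⟨?_, ?_⟩)
    (fun h ↦ ⟨?_, ?_⟩)
  · simp [CIStructure.triples, hac, Finset.disjoint_left]
  · refine (CIStructure.condIndepCoords_singleton_iff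
      (hr.mono (fun v hv ↦ ?_) fun v hv hvC ↦ hr' v ?_)).2 h
    · simp [hC] at hv ⊢; tauto
    · simp [hC] at hv hvC ⊢; tauto
  · simp [CIStructure.triples, hce, Finset.disjoint_left]
  · refine CIStructure.CondIndepCoords.symm ((CIStructure.condIndepCoords_singleton_iff
      (hs.mono (fun v hv ↦ ?_) fun v hv hvC ↦ hs' v ?_)).2 h)
    · simp [hC] at hv ⊢; tauto
    · simp [hC] at hv hvC ⊢; tauto
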